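/- Let $R=\{(A,B,C,D)\in \mathrm{SL}_2(\mathbb{C})^4 : [A,B]\,[C,D]=I\}$, where $[X,Y]=XYX^{-1}Y^{-1}$, be the affine algebraic set of representations of the genus-$2$ surface group in $\mathrm{SL}_2(\mathbb{C})$, and let $\mathcal{O}(R)$ be its ring of regular functions (functions $R\to\mathbb{C}$ given by polynomials in the matrix entries). Let $\mathcal{M}_2=R/\!/\mathrm{SL}_2(\mathbb{C})$ be the character variety, i.e. the GIT quotient by simultaneous conjugation, with coordinate ring $\mathcal{O}_{\mathcal{M}_2}=\mathcal{O}(R)^{\mathrm{SL}_2(\mathbb{C})}$. For a product $W$ of the matrices $A,B,C,D$, let $t_W\in\mathcal{O}_{\mathcal{M}_2}$ denote the function $(A,B,C,D)\mapsto \operatorname{tr} W$. Then $t_A,t_B,t_C,t_D,t_{AB},t_{AC}$ form a transcendence basis of $\mathcal{O}_{\mathcal{M}_2}$ over $\mathbb{C}$: they are algebraically independent over $\mathbb{C}$ (and maximal as an algebraically independent family), and every element of $\mathcal{O}_{\mathcal{M}_2}$ is algebraic over the subring $\mathbb{C}[t_A,t_B,t_C,t_D,t_{AB},t_{AC}]$,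 i.e. is a root of a nonzero polynomial with coefficients in that subring. -/

import Mathlib

open scoped commutatorElement

namespace GenusTwo

/-- The representation space of the genus 2 surface group `⟨a, b, c, d | [a,b][c,d] = 1⟩` in
`SL₂(k)`: quadruples `(A, B, C, D)` with `[A,B][C,D] = I`, where `[X,Y] = X Y X⁻¹ Y⁻¹`. -/
def RepSpace (k : Type*) [Field k] : Set (Fin 4 → Matrix.SpecialLinearGroup (Fin 2) k) :=
  {ρ | ⁅ρ 0, ρ 1⁆ * ⁅ρ 2, ρ 3⁆ = 1}

/-- Simultaneous conjugation `(A, B, C, D) ↦ (PAP⁻¹, PBP⁻¹, PCP⁻¹, PDP⁻¹)`. -/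
def conj {k : Type*} [Field k] (P : Matrix.SpecialLinearGroup (Fin 2) k) (ρ : RepSpace k) :
    RepSpace k :=
  ⟨fun i => P * ρ.1 i * P⁻¹, by
    have h : ⁅ρ.1 0, ρ.1 1⁆ * ⁅ρ.1 2, ρ.1 3⁆ = 1 := ρ.2
    have h' : ⁅P * ρ.1 0 * P⁻¹, P * ρ.1 1 * P⁻¹⁆ * ⁅P * ρ.1 2 * P⁻¹, P * ρ.1 3 * P⁻¹⁆ =
        P * (⁅ρ.1 0, ρ.1 1⁆ * ⁅ρ.1 2, ρ.1 3⁆) * P⁻¹ := by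
      simp only [commutatorElement_def]
      group
    change ⁅P * ρ.1 0 * P⁻¹, P * ρ.1 1 * P⁻¹⁆ * ⁅P * ρ.1 2 * P⁻¹, P * ρ.1 3 * P⁻¹⁆ = 1
    rw [h', h]
    group⟩

/-- The `(r, s)` entry of the `i`-th matrix, as a function on the representation space;
the index is `(i, r, s)`. -/
def entry (k : Type*) [Field k] (v : Fin 4 × Fin 2 × Fin 2) : RepSpace k → k :=
  fun ρ => (ρ.1 v.1).1 v.2.1 v.2.2

/-- The ring of regular functions of the affine algebraic set `RepSpace k`: the functions which
are given by a polynomial in the sixteen matrix entries. -/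
noncomputable def regularFunctions (k : Type*) [Field k] : Subalgebra k (RepSpace k → k) :=
  (MvPolynomial.aeval (entry k) : MvPolynomial (Fin 4 × Fin 2 × Fin 2) k →ₐ[k] _).range

/-- The coordinate ring of the GIT quotient `RepSpace k // SL₂(k)`: the regular functions which
are invariant under simultaneous conjugation. -/
noncomputable def coordinateRing (k : Type*) [Field k] : Subalgebra k (RepSpace k → k) where
  carrier := {f | f ∈ regularFunctions k ∧
    ∀ (P : Matrix.SpecialLinearGroup (Fin 2) k) (ρ : RepSpace k), f (conj P ρ) = f ρ}
  mul_mem' := fun hf hg => ⟨mul_mem hf.1 hg.1, fun P ρ => by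
    simp only [Pi.mul_apply, hf.2 P ρ, hg.2 P ρ]⟩
  add_mem' := fun hf hg => ⟨add_mem hf.1 hg.1, fun P ρ => by
    simp only [Pi.add_apply, hf.2 P ρ, hg.2 P ρ]⟩
  algebraMap_mem' := fun c => ⟨Subalgebra.algebraMap_mem _ c, fun _ _ => rfl⟩

theorem entry_prod_mem (k : Type*) [Field k] (l : List (Fin 4)) : ∀ r s : Fin 2,
    (fun ρ : RepSpace k => (l.map ρ.1).prod.1 r s) ∈ regularFunctions k := by
  induction l with
  | nil =>
    intro r s
    exact Subalgebra.algebraMap_mem (regularFunctions k) ((1 : Matrix (Fin 2) (Fin 2) k) r s)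
  | cons i l ih =>
    intro r s
    have h : (fun ρ : RepSpace k => ((i :: l).map ρ.1).prod.1 r s) =
        ∑ j : Fin 2, entry k (i, r, j) * (fun ρ : RepSpace k => (l.map ρ.1).prod.1 j s) := by
      funext ρ
      simp [Matrix.mul_apply, entry]
    rw [h]
    exact sum_mem fun j _ => mul_mem ⟨MvPolynomial.X (i, r, j), by simp⟩ (ih j s)

theorem prod_conj {k : Type*} [Field k] (P : Matrix.SpecialLinearGroup (Fin 2) k)
    (ρ : RepSpace k) (l : List (Fin 4)) :
    (l.map (conj P ρ).1).prod = P * (l.map ρ.1).prod * P⁻¹ := by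
  induction l with
  | nil => simp
  | cons i l ih =>
    rw [List.map_cons, List.prod_cons, ih, List.map_cons, List.prod_cons]
    simp only [conj]
    group

/-- For a word `i₁ … iₚ`, the trace function `(A₀, A₁, A₂, A₃) ↦ tr (A_{i₁} ⋯ A_{iₚ})`, as an
element of the coordinate ring of the GIT quotient. -/
noncomputable def traceFn (k : Type*) [Field k] (l : List (Fin 4)) : coordinateRing k :=
  ⟨fun ρ => Matrix.trace (l.map ρ.1).prod.1, by
    constructor
    · have h : (fun ρ : RepSpace k => Matrix.trace (l.map ρ.1).prod.1) =
          ∑ j : Fin 2, fun ρ : RepSpace k => (l.map ρ.1).prod.1 j j := by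
        funext ρ
        simp [Matrix.trace]
      rw [h]
      exact sum_mem fun j _ => entry_prod_mem k l j j
    · intro P ρ
      change Matrix.trace (l.map (conj P ρ).1).prod.1 = _
      rw [prod_conj, Matrix.SpecialLinearGroup.coe_mul, Matrix.trace_mul_comm,
        ← Matrix.SpecialLinearGroup.coe_mul]
      simp⟩

/-- The six functions `t_A, t_B, t_C, t_D, t_{AB}, t_{AC}`, where `(A, B, C, D)` is
`(A₀, A₁, A₂, A₃)`. -/
noncomputable def sixTraces (k : Type*) [Field k] : Fin 6 → coordinateRing k :=
  ![traceFn k [0], traceFn k [1], traceFn k [2], traceFn k [3],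
    traceFn k [0, 1], traceFn k [0, 2]]

end GenusTwo

namespace GenusTwo
open Matrix

/-! Six is the number of free parameters of a generic representation. Up to conjugation, `A` is
diagonal and `B` has upper right entry `1`. Then `t_A`, `t_B`, `t_AB` fix `A` and `B` up to choosing
a root, and `t_C`, `t_AC` fix the diagonal of `C`. Writing the relation as `[C, D] = K` with `K =
[B, A]`, it forces `tr (C⁻¹K) = tr C`, which is linear in the off-diagonal entries of `C`; with `det
C = 1` this leaves a quadratic equation. Finally `D` is a rational expression in `C`, `K`, `tr D`
and `tr CD`, where `tr CD` is a root of Fricke's quadratic.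

Solving these equations for given generic values (`exists_rep_of_traces`) makes the image of the six
traces contain a nonempty Zariski open set, hence independence. Reading them as equations for the
entries (`entries_mem`) shows that the entries, and so all invariant functions on generic
representations, are algebraic over the traces. -/

/-- A monic quadratic polynomial over `ℂ` has a root. -/
theorem exists_quadratic_root (p q : ℂ) : ∃ z : ℂ, z ^ 2 - p * z + q = 0 := by
  obtain ⟨s, hs⟩ := IsAlgClosed.exists_pow_nat_eq (p ^ 2 - 4 * q) (n := 2) (by norm_num)
  exact ⟨(p + s) / 2, by linear_combination hs / 4⟩

/-! ### Solving `[C, D] = K` in `SL₂` -/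

section
variable {k : Type*} [Field k]

theorem det_eq_one (X : SpecialLinearGroup (Fin 2) k) :
    X.1 0 0 * X.1 1 1 - X.1 0 1 * X.1 1 0 = 1 := by
  rw [← Matrix.det_fin_two, X.2]

/-- If `D C⁻¹ D⁻¹ = E` in `SL₂`, then `D` is determined by `C`, `E`, `tr D` and `tr CD`, as soon
as `det (E - C) ≠ 0`. -/
theorem smul_eq_of_mul_inv_eq (C D E : SpecialLinearGroup (Fin 2) k) (h : D * C⁻¹ = E * D) :
    (trace (C.1 * E.1) + 2 - trace C.1 ^ 2) • D.1 =
      (E.1 - C.1) * (trace (C.1 * D.1) • 1 - trace D.1 • (C⁻¹).1) := by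
  -- Conceptually, Cayley–Hamilton gives `tr (CD) - tr D • C⁻¹ = (C - E) D`. As `E - C` has trace
  -- zero, `(E - C)² = -det (E - C)`, and the scalar on the left is `det (E - C)`.
  have hE : E = D * C⁻¹ * D⁻¹ := by rw [h]; group
  have hC := det_eq_one C
  have hD := det_eq_one D
  subst hE
  ext i j
  fin_cases i <;> fin_cases j <;>
  simp [Matrix.trace_fin_two, Matrix.mul_apply, Fin.sum_univ_two,
      Matrix.adjugate_fin_two, Matrix.one_apply] <;> grind
end

/-- Prescribing the trace of a solution `D` of `[C, D] = K`. -/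
theorem exists_commutator_eq (C K : SpecialLinearGroup (Fin 2) ℂ)
    (h : trace (C⁻¹ * K).1 = trace C.1) (hK : trace K.1 + 2 - trace C.1 ^ 2 ≠ 0) (d : ℂ) :
    ∃ D : SpecialLinearGroup (Fin 2) ℂ, trace D.1 = d ∧ ⁅C, D⁆ = K := by
  obtain ⟨E, rfl⟩ : ∃ E, K = C * E := ⟨C⁻¹ * K, by group⟩
  rw [inv_mul_cancel_left] at h
  set δ := trace (C * E).1 + 2 - trace C.1 ^ 2 with hδ
  -- `z` is the future `tr (CD)`: this quadratic is Fricke's formula for `tr [C, D] = tr K`. The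
  -- matrix `N` will be `δ • D`.
  obtain ⟨z, hz⟩ := exists_quadratic_root (trace C.1 * d)
    (d ^ 2 - δ)
  let N : Matrix (Fin 2) (Fin 2) ℂ := (E.1 - C.1) * (z • 1 - d • (C⁻¹).1)
  have hC := det_eq_one C
  have hE := det_eq_one E
  have hN : N.det = δ ^ 2 := by
    rw [Matrix.det_mul]
    have h1 : (E.1 - C.1).det = δ := by
      rw [hδ]
      simp [Matrix.trace_fin_two, Matrix.mul_apply, Fin.sum_univ_two, Matrix.det_fin_two] at h ⊢
      grind
    have h2 : (z • 1 - d • (C⁻¹).1).det = δ := by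
      simp [Matrix.trace_fin_two, Matrix.det_fin_two,
        Matrix.adjugate_fin_two] at hz ⊢
      grind
    rw [h1, h2, sq]
  have htr : trace N = δ * d := by
    rw [hδ]
    simp [N, Matrix.trace_fin_two, Matrix.mul_apply, Fin.sum_univ_two,
      Matrix.adjugate_fin_two] at h ⊢
    grind
  have hcomm : N * (C⁻¹).1 = E.1 * N := by
    ext i j
    fin_cases i <;> fin_cases j <;>
    simp [N, Matrix.trace_fin_two, Matrix.mul_apply, Fin.sum_univ_two,
      Matrix.adjugate_fin_two, Matrix.one_apply] at h ⊢ <;> grind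
  let D : SpecialLinearGroup (Fin 2) ℂ := ⟨δ⁻¹ • N, by
    rw [Matrix.det_smul, hN, Fintype.card_fin, ← mul_pow, inv_mul_cancel₀ hK, one_pow]⟩
  have hD : D * C⁻¹ = E * D := by
    apply Subtype.ext
    change (δ⁻¹ • N) * (C⁻¹).1 = E.1 * (δ⁻¹ • N)
    rw [Matrix.smul_mul, hcomm, Matrix.mul_smul]
  refine ⟨D, ?_, ?_⟩
  · change trace (δ⁻¹ • N) = d
    rw [Matrix.trace_smul, htr, smul_eq_mul, inv_mul_cancel_left₀ hK]
  · rw [commutatorElement_def, mul_assoc C, hD]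
    group

/-- Fricke's formula for the trace of a commutator. -/
theorem trace_commutator {k : Type*} [Field k] (A B : SpecialLinearGroup (Fin 2) k) :
    trace ⁅B, A⁆.1 = trace A.1 ^ 2 + trace B.1 ^ 2 + trace (A * B).1 ^ 2
      - trace A.1 * trace B.1 * trace (A * B).1 - 2 := by
  have hA := det_eq_one A
  have hB := det_eq_one B
  simp [commutatorElement_def, Matrix.trace_fin_two, Matrix.mul_apply, Fin.sum_univ_two,
      Matrix.adjugate_fin_two]
  grind

/-- For `A` diagonal and `B` with upper right entry `1`, the condition that `C` and `C⁻¹[B, A]`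
have the same trace is linear in the off-diagonal entries of `C`. -/
theorem trace_inv_mul_commutator {k : Type*} [Field k] (A B C : SpecialLinearGroup (Fin 2) k)
    (hA : A.1 0 1 = 0) (hA' : A.1 1 0 = 0) (hB : B.1 0 1 = 1) :
    trace (C⁻¹ * ⁅B, A⁆).1 - trace C.1 = (A.1 0 0 - A.1 1 1) *
      (B.1 1 0 * (C.1 1 1 * A.1 1 1 - C.1 0 0 * A.1 0 0)
        - C.1 0 1 * (B.1 1 0 * B.1 1 1 * A.1 1 1) + C.1 1 0 * (B.1 0 0 * A.1 0 0)) := by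
  have h1 := det_eq_one A
  have h2 := det_eq_one B
  simp [commutatorElement_def, Matrix.trace_fin_two, Matrix.mul_apply, Fin.sum_univ_two,
      Matrix.adjugate_fin_two, Matrix.vecMul, dotProduct]
  grind

/-! ### Representations with prescribed generic traces -/

/-- Generic values of the six traces are attained. -/
theorem exists_rep_of_traces (a b c d x y : ℂ) (h1 : a ^ 2 - 4 ≠ 0)
    (h2 : x ^ 2 - a * b * x + b ^ 2 + a ^ 2 - 4 ≠ 0) (h3 : x ^ 2 - a * b * x + b ^ 2 ≠ 0)
    (h4 : a ^ 2 + b ^ 2 + x ^ 2 - a * b * x - c ^ 2 ≠ 0) :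
    ∃ ρ : RepSpace ℂ, trace (ρ.1 0).1 = a ∧ trace (ρ.1 1).1 = b ∧ trace (ρ.1 2).1 = c ∧
      trace (ρ.1 3).1 = d ∧ trace (ρ.1 0 * ρ.1 1).1 = x ∧ trace (ρ.1 0 * ρ.1 2).1 = y := by
  obtain ⟨l, hl⟩ := exists_quadratic_root a 1
  obtain ⟨m, hm⟩ : ∃ m, l + m = a := ⟨a - l, by ring⟩
  have hlm : l * m = 1 := by grind
  have hw : l - m ≠ 0 := by grind
  obtain ⟨p, hp⟩ : ∃ p, (l - m) * p = x - m * b := ⟨(x - m * b) / (l - m), by field_simp⟩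
  obtain ⟨s, hs⟩ : ∃ s, p + s = b := ⟨b - p, by ring⟩
  have hps : (a ^ 2 - 4) * (p * s) = -(x ^ 2 - a * b * x + b ^ 2) := by grind
  obtain ⟨r, hr⟩ : ∃ r, p * s - r = 1 := ⟨p * s - 1, by ring⟩
  have hr0 : r ≠ 0 := by grind
  have hp0 : p ≠ 0 := by grind
  have hs0 : s ≠ 0 := by grind
  have hl0 : l ≠ 0 := by grind
  have hm0 : m ≠ 0 := by grind
  obtain ⟨e, he⟩ : ∃ e, (l - m) * e = y - m * c := ⟨(y - m * c) / (l - m), by field_simp⟩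
  obtain ⟨h, hh⟩ : ∃ h, e + h = c := ⟨c - e, by ring⟩
  obtain ⟨n, hn⟩ : ∃ n, n = r * (h * m - e * l) := ⟨_, rfl⟩
  have hk : r * s * m ≠ 0 := by simp [*]
  have hk' : p * l ≠ 0 := by simp [*]
  -- Eliminating `g` between the linear trace condition `n - f r s m + g p l = 0` and `e h - f g =
  -- 1` leaves this quadratic in `f`.
  obtain ⟨f, hf⟩ := exists_quadratic_root (n / (r * s * m)) (-(p * l) * (e * h - 1) / (r * s * m))
  replace hf : f ^ 2 * (r * s * m) - n * f - (p * l) * (e * h - 1) = 0 := by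
    field_simp at hf
    linear_combination hf
  obtain ⟨g, hg⟩ : ∃ g, n - f * (r * s * m) + g * (p * l) = 0 :=
    ⟨-(n - f * (r * s * m)) / (p * l), by field_simp; ring⟩
  have hfg : e * h - f * g = 1 := by
    apply mul_left_cancel₀ hk'
    linear_combination -hf - f * hg
  let A : SpecialLinearGroup (Fin 2) ℂ := ⟨!![l, 0; 0, m], by simp [hlm]⟩
  let B : SpecialLinearGroup (Fin 2) ℂ := ⟨!![p, 1; r, s], by simp [hr]⟩
  let C : SpecialLinearGroup (Fin 2) ℂ := ⟨!![e, f; g, h], by simp [hfg]⟩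
  have tA : trace A.1 = a := by simp [A, Matrix.trace_fin_two, hm]
  have tB : trace B.1 = b := by simp [B, Matrix.trace_fin_two, hs]
  have tC : trace C.1 = c := by simp [C, Matrix.trace_fin_two, hh]
  have tAB : trace (A * B).1 = x := by
    change trace (A.1 * B.1) = _
    simp [A, B, Matrix.trace_fin_two]
    linear_combination hp + m * hs
  have tAC : trace (A * C).1 = y := by
    change trace (A.1 * C.1) = _
    simp [A, C, Matrix.trace_fin_two]
    linear_combination he + m * hh
  obtain ⟨D, hD, hCD⟩ := exists_commutator_eq C ⁅B, A⁆ (by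
    rw [← sub_eq_zero, trace_inv_mul_commutator A B C rfl rfl rfl]
    simp only [A, B, C, Matrix.of_apply, Matrix.cons_val_zero, Matrix.cons_val_one]
    linear_combination (l - m) * (hg - hn)) (by
    rw [trace_commutator, tA, tB, tAB, tC]
    convert h4 using 1
    ring) d
  refine ⟨⟨![A, B, C, D], ?_⟩, tA, tB, tC, hD, tAB, tAC⟩
  change ⁅A, B⁆ * ⁅C, D⁆ = 1
  rw [hCD, ← commutatorElement_inv, inv_mul_cancel]

/-! ### Normal form under conjugation -/

theorem conj_val {k : Type*} [Field k] (P X : SpecialLinearGroup (Fin 2) k) :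
    (P * X * P⁻¹).1 = P.1 * X.1 * !![P.1 1 1, -P.1 0 1; -P.1 1 0, P.1 0 0] := by
  rw [← Matrix.adjugate_fin_two]
  rfl

theorem trace_conj {k : Type*} [Field k] (P X : SpecialLinearGroup (Fin 2) k) :
    trace (P * X * P⁻¹).1 = trace X.1 := by
  have h : (P⁻¹).1 * P.1 = 1 := congrArg Subtype.val (inv_mul_cancel P)
  change trace (P.1 * X.1 * (P⁻¹).1) = _
  rw [Matrix.trace_mul_comm, ← Matrix.mul_assoc, h, Matrix.one_mul]

/-- A matrix in `SL₂` with two different eigenvalues is diagonalizable over `SL₂`. -/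
theorem exists_conj_diagonal (A : SpecialLinearGroup (Fin 2) ℂ) (hA : trace A.1 ^ 2 - 4 ≠ 0) :
    ∃ P : SpecialLinearGroup (Fin 2) ℂ, (P * A * P⁻¹).1 0 1 = 0 ∧ (P * A * P⁻¹).1 1 0 = 0 := by
  obtain ⟨l, hl⟩ := exists_quadratic_root (trace A.1) 1
  rw [Matrix.trace_fin_two] at hA hl
  have hdet := det_eq_one A
  obtain ⟨m, hm⟩ : ∃ m, l + m = A.1 0 0 + A.1 1 1 := ⟨A.1 0 0 + A.1 1 1 - l, by ring⟩
  have hw : m - l ≠ 0 := by grind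
  by_cases h : A.1 0 1 = 0
  · have hw' : A.1 0 0 - A.1 1 1 ≠ 0 := by grind
    obtain ⟨P, hP⟩ : ∃ P : SpecialLinearGroup (Fin 2) ℂ,
        P.1 = !![1, 0; -A.1 1 0 / (A.1 0 0 - A.1 1 1), 1] := ⟨⟨_, by simp⟩, rfl⟩
    refine ⟨P, ?_, ?_⟩ <;> rw [conj_val, hP]
    · simp [Matrix.mul_apply, Fin.sum_univ_two, Matrix.vecMul, dotProduct, h]
    · simp [Matrix.mul_apply, Fin.sum_univ_two, Matrix.vecMul, dotProduct, h]
      field_simp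
      ring
  -- The rows are left eigenvectors of `A` for `l` and `m`, scaled so that `det P = 1`.
  · obtain ⟨P, hP⟩ : ∃ P : SpecialLinearGroup (Fin 2) ℂ,
        P.1 = !![m - A.1 0 0, -A.1 0 1; -(l - A.1 0 0) / (A.1 0 1 * (m - l)), 1 / (m - l)] :=
      ⟨⟨_, by
        simp
        field_simp
        ring⟩, rfl⟩
    refine ⟨P, ?_, ?_⟩ <;> rw [conj_val, hP]
    · simp [Matrix.mul_apply, Fin.sum_univ_two, Matrix.vecMul, dotProduct]
      grind
    · simp [Matrix.mul_apply, Fin.sum_univ_two, Matrix.vecMul, dotProduct]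
      field_simp
      grind

/-- Normal form of a generic pair of matrices in `SL₂` up to simultaneous conjugation. -/
theorem exists_conj_normal_form (A B : SpecialLinearGroup (Fin 2) ℂ) (hA : trace A.1 ^ 2 - 4 ≠ 0)
    (hAB : trace (A * B).1 ^ 2 - trace A.1 * trace B.1 * trace (A * B).1 + trace B.1 ^ 2
      + trace A.1 ^ 2 - 4 ≠ 0) :
    ∃ P : SpecialLinearGroup (Fin 2) ℂ, (P * A * P⁻¹).1 0 1 = 0 ∧ (P * A * P⁻¹).1 1 0 = 0 ∧
      (P * B * P⁻¹).1 0 1 = 1 := by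
  obtain ⟨P, h01, h10⟩ := exists_conj_diagonal A hA
  have hmul : P * (A * B) * P⁻¹ = (P * A * P⁻¹) * (P * B * P⁻¹) := by group
  rw [← trace_conj P A, ← trace_conj P B, ← trace_conj P (A * B), hmul] at hAB
  have conj_mul (Q X : SpecialLinearGroup (Fin 2) ℂ) :
      (Q * P) * X * (Q * P)⁻¹ = Q * (P * X * P⁻¹) * Q⁻¹ := by group
  have hA1 := det_eq_one (P * A * P⁻¹)
  have hB1 := det_eq_one (P * B * P⁻¹)
  generalize hA' : P * A * P⁻¹ = A' at *
  generalize hB' : P * B * P⁻¹ = B' at *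
  have hq : B'.1 0 1 ≠ 0 := by
    intro h0
    apply hAB
    simp [Matrix.trace_fin_two, Matrix.mul_apply, Fin.sum_univ_two]
    grind
  -- Conjugation by `diag(ν⁻¹, ν)` divides the upper right entry by `ν²`.
  obtain ⟨ν, hν⟩ := IsAlgClosed.exists_pow_nat_eq (B'.1 0 1) (n := 2) (by norm_num)
  have hν0 : ν ≠ 0 := by grind
  obtain ⟨Q, hQ⟩ : ∃ Q : SpecialLinearGroup (Fin 2) ℂ, Q.1 = !![ν⁻¹, 0; 0, ν] :=
    ⟨⟨_, by simp [hν0]⟩, rfl⟩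
  refine ⟨Q * P, ?_, ?_, ?_⟩
  all_goals
    first
      | rw [conj_mul, conj_val, hQ, hA']
      | rw [conj_mul, conj_val, hQ, hB']
    simp [Matrix.mul_apply, Fin.sum_univ_two, Matrix.vecMul, dotProduct, h01, h10, ← hν]
  field_simp

/-! ### Entries of the normal form as iterated quadratic roots -/

section
variable {U : Type*} {S : Subring (U → ℂ)}

theorem mem_of_mul_mem (hinv : ∀ g ∈ S, (∀ u, g u ≠ 0) → g⁻¹ ∈ S) {g h : U → ℂ} (hg : g ∈ S)
    (hg0 : ∀ u, g u ≠ 0) (hgh : g * h ∈ S) : h ∈ S := by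
  have : h = g⁻¹ * (g * h) := by
    funext u
    simp [hg0 u]
  rw [this]
  exact mul_mem (hinv g hg hg0) hgh

/-- A ring of functions closed under square roots and under inversion of functions without zeros
contains the roots of quadratic equations with coefficients in it. -/
theorem mem_of_quadratic (hsqrt : ∀ g : U → ℂ, g ^ 2 ∈ S → g ∈ S)
    (hinv : ∀ g ∈ S, (∀ u, g u ≠ 0) → g⁻¹ ∈ S) {α β γ z : U → ℂ} (hα : α ∈ S) (hβ : β ∈ S)
    (hγ : γ ∈ S) (hα0 : ∀ u, α u ≠ 0) (h : α * z ^ 2 + β * z + γ = 0) : z ∈ S := by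
  have two_mem : (2 : U → ℂ) ∈ S := by
    rw [← one_add_one_eq_two]
    exact add_mem (one_mem S) (one_mem S)
  refine mem_of_mul_mem hinv (mul_mem two_mem hα) (fun u => by simp [hα0 u]) ?_
  have h1 : 2 * α * z + β ∈ S := by
    refine hsqrt _ ?_
    have : (2 * α * z + β) ^ 2 = β ^ 2 - 2 ^ 2 * (α * γ) := by linear_combination 4 * α * h
    rw [this]
    exact sub_mem (pow_mem hβ 2) (mul_mem (pow_mem two_mem 2) (mul_mem hα hγ))
  rw [← add_sub_cancel_right (2 * α * z) β]
  exact sub_mem h1 hβ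

theorem entries_mul_mem {X Y : U → Matrix (Fin 2) (Fin 2) ℂ}
    (hX : ∀ i j, (fun u => X u i j) ∈ S) (hY : ∀ i j, (fun u => Y u i j) ∈ S) (i j : Fin 2) :
    (fun u => (X u * Y u) i j) ∈ S := by
  have : (fun u => (X u * Y u) i j) =
      (fun u => X u i 0) * (fun u => Y u 0 j) + (fun u => X u i 1) * (fun u => Y u 1 j) := by
    funext u
    simp [Matrix.mul_apply, Fin.sum_univ_two]
  rw [this]
  exact add_mem (mul_mem (hX i 0) (hY 0 j)) (mul_mem (hX i 1) (hY 1 j))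

theorem entries_inv_mem {X : U → SpecialLinearGroup (Fin 2) ℂ}
    (hX : ∀ i j, (fun u => (X u).1 i j) ∈ S) (i j : Fin 2) :
    (fun u => ((X u)⁻¹).1 i j) ∈ S := by
  have h (u : U) : ((X u)⁻¹).1 = !![(X u).1 1 1, -(X u).1 0 1; -(X u).1 1 0, (X u).1 0 0] := by
    rw [← Matrix.adjugate_fin_two]
    rfl
  simp only [h]
  fin_cases i <;> fin_cases j
  · exact hX 1 1
  · exact neg_mem (hX 0 1)
  · exact neg_mem (hX 1 0)
  · exact hX 0 0

/-- Used to turn genericity of the traces into nonvanishing of the diagonal entries of `B` and of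
its lower left entry `p * s - 1`. -/
theorem diagonal_mul_eq {l m p s a b x : ℂ} (hlm : l * m = 1) (ha : l + m = a) (hb : p + s = b)
    (hx : l * p + m * s = x) : (a ^ 2 - 4) * (p * s) = -(x ^ 2 - a * b * x + b ^ 2) := by
  subst ha hb hx
  grind

/-- The entries of a family of representations in normal form belong to every ring of functions
which contains the six traces and is closed under square roots and inverses. -/
theorem entries_mem (hsqrt : ∀ g : U → ℂ, g ^ 2 ∈ S → g ∈ S)
    (hinv : ∀ g ∈ S, (∀ u, g u ≠ 0) → g⁻¹ ∈ S) (A B C D : U → SpecialLinearGroup (Fin 2) ℂ)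
    (hA01 : ∀ u, (A u).1 0 1 = 0) (hA10 : ∀ u, (A u).1 1 0 = 0) (hB01 : ∀ u, (B u).1 0 1 = 1)
    (hrel : ∀ u, ⁅A u, B u⁆ * ⁅C u, D u⁆ = 1) {a b c d x y : U → ℂ}
    (ha : a ∈ S) (hb : b ∈ S) (hc : c ∈ S) (hd : d ∈ S) (hx : x ∈ S) (hy : y ∈ S)
    (tA : ∀ u, trace (A u).1 = a u) (tB : ∀ u, trace (B u).1 = b u)
    (tC : ∀ u, trace (C u).1 = c u) (tD : ∀ u, trace (D u).1 = d u)
    (tAB : ∀ u, trace (A u * B u).1 = x u) (tAC : ∀ u, trace (A u * C u).1 = y u)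
    (h1 : ∀ u, a u ^ 2 - 4 ≠ 0)
    (h2 : ∀ u, x u ^ 2 - a u * b u * x u + b u ^ 2 + a u ^ 2 - 4 ≠ 0)
    (h3 : ∀ u, x u ^ 2 - a u * b u * x u + b u ^ 2 ≠ 0)
    (h4 : ∀ u, a u ^ 2 + b u ^ 2 + x u ^ 2 - a u * b u * x u - c u ^ 2 ≠ 0) (i j : Fin 2) :
    (fun u => (A u).1 i j) ∈ S ∧ (fun u => (B u).1 i j) ∈ S ∧ (fun u => (C u).1 i j) ∈ S ∧
      (fun u => (D u).1 i j) ∈ S := by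
  have hK (u : U) : ⁅C u, D u⁆ = ⁅B u, A u⁆ :=
    (eq_inv_of_mul_eq_one_right (hrel u)).trans (commutatorElement_inv _ _)
  have hAdet (u : U) := det_eq_one (A u)
  have hBdet (u : U) := det_eq_one (B u)
  have hCdet (u : U) := det_eq_one (C u)
  simp only [hA01, hA10, hB01, zero_mul, sub_zero, one_mul] at hAdet hBdet
  have sA (u : U) : (A u).1 0 0 + (A u).1 1 1 = a u := by rw [← tA, Matrix.trace_fin_two]
  have sB (u : U) : (B u).1 0 0 + (B u).1 1 1 = b u := by rw [← tB, Matrix.trace_fin_two]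
  have sC (u : U) : (C u).1 0 0 + (C u).1 1 1 = c u := by rw [← tC, Matrix.trace_fin_two]
  have sAB (u : U) : (A u).1 0 0 * (B u).1 0 0 + (A u).1 1 1 * (B u).1 1 1 = x u := by
    rw [← tAB]
    change _ = trace ((A u).1 * (B u).1)
    simp [Matrix.trace_fin_two, Matrix.mul_apply, Fin.sum_univ_two, hA01, hA10]
  have sAC (u : U) : (A u).1 0 0 * (C u).1 0 0 + (A u).1 1 1 * (C u).1 1 1 = y u := by
    rw [← tAC]
    change _ = trace ((A u).1 * (C u).1)
    simp [Matrix.trace_fin_two, Matrix.mul_apply, Fin.sum_univ_two, hA01, hA10]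
  have hw (u : U) : (A u).1 0 0 - (A u).1 1 1 ≠ 0 := by grind
  have hlin (u : U) := trace_inv_mul_commutator (A u) (B u) (C u) (hA01 u) (hA10 u) (hB01 u)
  have htr (u : U) : trace ((C u)⁻¹ * ⁅B u, A u⁆).1 = trace (C u).1 := by
    have : (C u)⁻¹ * ⁅C u, D u⁆ = D u * (C u)⁻¹ * (D u)⁻¹ := by
      rw [commutatorElement_def]
      group
    rw [← hK, this, trace_conj]
    change trace (adjugate (C u).1) = _
    rw [Matrix.adjugate_fin_two, Matrix.trace_fin_two, Matrix.trace_fin_two]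
    exact add_comm _ _
  -- The entries of `A`.
  have mA0 : (fun u => (A u).1 0 0) ∈ S :=
    mem_of_quadratic hsqrt hinv (one_mem S) (neg_mem ha) (one_mem S) (by simp) (by
      funext u
      simp only [Pi.add_apply, Pi.mul_apply, Pi.pow_apply, Pi.neg_apply, Pi.one_apply,
        Pi.zero_apply]
      grind)
  have mA1 : (fun u => (A u).1 1 1) ∈ S := by
    rw [show (fun u => (A u).1 1 1) = a - fun u => (A u).1 0 0 by
      funext u; simp [← sA]]
    exact sub_mem ha mA0
  have mA : ∀ i j, (fun u => (A u).1 i j) ∈ S := by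
    intro i j
    fin_cases i <;> fin_cases j
    · exact mA0
    · simp only [Fin.zero_eta, Fin.mk_one, hA01]
      exact zero_mem S
    · simp only [Fin.zero_eta, Fin.mk_one, hA10]
      exact zero_mem S
    · exact mA1
  -- The diagonal entries of `B` and `C`.
  have diag {s t : U → ℂ} (hs : s ∈ S) (ht : t ∈ S) (X : U → SpecialLinearGroup (Fin 2) ℂ)
      (sX : ∀ u, (X u).1 0 0 + (X u).1 1 1 = s u)
      (sAX : ∀ u, (A u).1 0 0 * (X u).1 0 0 + (A u).1 1 1 * (X u).1 1 1 = t u) :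
      (fun u => (X u).1 0 0) ∈ S ∧ (fun u => (X u).1 1 1) ∈ S := by
    have h : (fun u => (X u).1 0 0) ∈ S := by
      refine mem_of_mul_mem hinv (sub_mem mA0 mA1) hw ?_
      convert sub_mem ht (mul_mem mA1 hs) using 1
      funext u
      simp only [Pi.mul_apply, Pi.sub_apply, ← sX, ← sAX]
      ring
    refine ⟨h, ?_⟩
    rw [show (fun u => (X u).1 1 1) = s - fun u => (X u).1 0 0 by
      funext u; simp [← sX]]
    exact sub_mem hs h
  obtain ⟨mB0, mB1⟩ := diag hb hx B sB sAB
  obtain ⟨mC0, mC1⟩ := diag hc hy C sC sAC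
  have mB10 : (fun u => (B u).1 1 0) ∈ S := by
    convert sub_mem (mul_mem mB0 mB1) (one_mem S) using 1
    funext u
    simp only [Pi.mul_apply, Pi.sub_apply, Pi.one_apply]
    linear_combination -hBdet u
  have mB : ∀ i j, (fun u => (B u).1 i j) ∈ S := by
    intro i j
    fin_cases i <;> fin_cases j
    · exact mB0
    · simp only [Fin.zero_eta, Fin.mk_one, hB01]
      exact one_mem S
    · exact mB10
    · exact mB1
  have hps (u : U) : (a u ^ 2 - 4) * ((B u).1 0 0 * (B u).1 1 1) =
      -(x u ^ 2 - a u * b u * x u + b u ^ 2) :=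
    diagonal_mul_eq (hAdet u) (sA u) (sB u) (sAB u)
  have hB00 (u : U) : (B u).1 0 0 ≠ 0 := fun h => h3 u (by
    linear_combination hps u - (a u ^ 2 - 4) * (B u).1 1 1 * h)
  have hB11 (u : U) : (B u).1 1 1 ≠ 0 := fun h => h3 u (by
    linear_combination hps u - (a u ^ 2 - 4) * (B u).1 0 0 * h)
  have hB10 (u : U) : (B u).1 1 0 ≠ 0 := fun h => h2 u (by
    linear_combination hps u - (a u ^ 2 - 4) * (hBdet u + h))
  have hA00 (u : U) : (A u).1 0 0 ≠ 0 := left_ne_zero_of_mul_eq_one (hAdet u)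
  have hA11 (u : U) : (A u).1 1 1 ≠ 0 := right_ne_zero_of_mul_eq_one (hAdet u)
  -- The off-diagonal entries of `C`.
  have hoff (u : U) : (B u).1 1 0 * ((C u).1 1 1 * (A u).1 1 1 - (C u).1 0 0 * (A u).1 0 0)
        - (C u).1 0 1 * ((B u).1 1 0 * (B u).1 1 1 * (A u).1 1 1)
        + (C u).1 1 0 * ((B u).1 0 0 * (A u).1 0 0) = 0 := by
    have := hlin u
    rw [htr, sub_self, eq_comm, mul_eq_zero] at this
    exact this.resolve_left (hw u)
  have mn := mul_mem mB10 (sub_mem (mul_mem mC1 mA1) (mul_mem mC0 mA0))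
  have mk := mul_mem (mul_mem mB10 mB1) mA1
  have mk' := mul_mem mB0 mA0
  have mC01 : (fun u => (C u).1 0 1) ∈ S :=
    mem_of_quadratic hsqrt hinv mk (neg_mem mn)
      (mul_mem (neg_mem mk') (sub_mem (mul_mem mC0 mC1) (one_mem S)))
      (fun u => mul_ne_zero (mul_ne_zero (hB10 u) (hB11 u)) (hA11 u)) (by
        funext u
        simp only [Pi.add_apply, Pi.mul_apply, Pi.pow_apply, Pi.neg_apply, Pi.one_apply,
          Pi.zero_apply, Pi.sub_apply]
        linear_combination -(C u).1 0 1 * hoff u - (B u).1 0 0 * (A u).1 0 0 * hCdet u)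
  have mC10 : (fun u => (C u).1 1 0) ∈ S := by
    refine mem_of_mul_mem hinv mk' (fun u => mul_ne_zero (hB00 u) (hA00 u)) ?_
    convert sub_mem (mul_mem mC01 mk) mn using 1
    funext u
    simp only [Pi.mul_apply, Pi.sub_apply]
    linear_combination hoff u
  have mC : ∀ i j, (fun u => (C u).1 i j) ∈ S := by
    intro i j
    fin_cases i <;> fin_cases j <;> assumption
  -- The entries of `D`.
  have mz : (fun u => trace ((C u).1 * (D u).1)) ∈ S := by
    refine mem_of_quadratic hsqrt hinv (one_mem S) (neg_mem (mul_mem hc hd))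
      (sub_mem (add_mem (pow_mem hc 2) (pow_mem hd 2)) (sub_mem (add_mem (add_mem (pow_mem ha 2)
        (pow_mem hb 2)) (pow_mem hx 2)) (mul_mem (mul_mem ha hb) hx))) (by simp) ?_
    funext u
    have k1 := trace_commutator (A u) (B u)
    have k2 := trace_commutator (D u) (C u)
    rw [← hK, k2, tA, tB, tC, tD, tAB] at k1
    have k3 : trace (D u * C u).1 = trace ((C u).1 * (D u).1) := Matrix.trace_mul_comm _ _
    rw [k3] at k1
    simp only [Pi.add_apply, Pi.mul_apply, Pi.pow_apply, Pi.neg_apply, Pi.one_apply,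
      Pi.zero_apply, Pi.sub_apply]
    linear_combination k1
  let E : U → SpecialLinearGroup (Fin 2) ℂ := fun u => (C u)⁻¹ * ⁅B u, A u⁆
  have mE : ∀ i j, (fun u => (E u).1 i j) ∈ S :=
    entries_mul_mem (entries_inv_mem mC) (entries_mul_mem (entries_mul_mem
      (entries_mul_mem mB mA) (entries_inv_mem mB)) (entries_inv_mem mA))
  have hD (u : U) : (a u ^ 2 + b u ^ 2 + x u ^ 2 - a u * b u * x u - c u ^ 2) • (D u).1 =
      ((E u).1 - (C u).1) * (trace ((C u).1 * (D u).1) • 1 - d u • ((C u)⁻¹).1) := by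
    have h := smul_eq_of_mul_inv_eq (C u) (D u) (E u) (by
      simp only [E, ← hK, commutatorElement_def]
      group)
    have k : trace ((C u).1 * (E u).1) = trace ⁅B u, A u⁆.1 := by
      change trace (C u * E u).1 = _
      rw [mul_inv_cancel_left]
    rw [← tD, ← h, k, trace_commutator, tA, tB, tAB, tC]
    congr 1
    ring
  have mD : ∀ i j, (fun u => (D u).1 i j) ∈ S := by
    intro i j
    refine mem_of_mul_mem hinv (sub_mem (sub_mem (add_mem (add_mem (pow_mem ha 2)
        (pow_mem hb 2)) (pow_mem hx 2)) (mul_mem (mul_mem ha hb) hx)) (pow_mem hc 2)) h4 ?_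
    convert entries_mul_mem (S := S) (X := fun u => (E u).1 - (C u).1)
      (Y := fun u => trace ((C u).1 * (D u).1) • 1 - d u • ((C u)⁻¹).1)
      (fun i j => sub_mem (mE i j) (mC i j)) (fun i j => ?_) i j using 1
    · funext u
      exact congrFun (congrFun (hD u) i) j
    · refine sub_mem (mul_mem mz ?_) (mul_mem hd (entries_inv_mem mC i j))
      rw [Matrix.one_apply]
      split_ifs
      · exact one_mem S
      · exact zero_mem S
  exact ⟨mA i j, mB i j, mC i j, mD i j⟩

end

/-! ### Algebraic independence -/

open MvPolynomial

/-- Evaluation of an invariant function at a representation. -/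
noncomputable def evalAt (ρ : RepSpace ℂ) : coordinateRing ℂ →ₐ[ℂ] ℂ :=
  (Pi.evalAlgHom ℂ (fun _ => ℂ) ρ).comp (coordinateRing ℂ).val

/-- The values of the six traces at a representation. -/
noncomputable def traceVector (ρ : RepSpace ℂ) : Fin 6 → ℂ := fun i => evalAt ρ (sixTraces ℂ i)

theorem evalAt_aeval (ρ : RepSpace ℂ) (P : MvPolynomial (Fin 6) ℂ) :
    evalAt ρ (aeval (sixTraces ℂ) P) = eval (traceVector ρ) P := by
  rw [← AlgHom.comp_apply, MvPolynomial.comp_aeval]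
  rfl

theorem traceVector_eq (ρ : RepSpace ℂ) : traceVector ρ =
    ![trace (ρ.1 0).1, trace (ρ.1 1).1, trace (ρ.1 2).1, trace (ρ.1 3).1,
      trace (ρ.1 0 * ρ.1 1).1, trace (ρ.1 0 * ρ.1 2).1] := by
  have h (l : List (Fin 4)) : evalAt ρ (traceFn ℂ l) = trace (l.map ρ.1).prod.1 := rfl
  funext i
  fin_cases i <;> simp only [traceVector, sixTraces]
  · exact (h [0]).trans (by simp)
  · exact (h [1]).trans (by simp)
  · exact (h [2]).trans (by simp)
  · exact (h [3]).trans (by simp)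
  · exact (h [0, 1]).trans (by simp)
  · exact (h [0, 2]).trans (by simp)

/-- The polynomial in the six traces whose nonvanishing is the genericity condition. -/
noncomputable def genericPoly : MvPolynomial (Fin 6) ℂ :=
  -- In order, nonvanishing of the factors means: `A` has distinct eigenvalues; `tr [A, B] ≠ 2`;
  -- given the first, the normal form of `B` has nonzero diagonal entries; `tr [B, A] + 2 - (tr C)²
  -- ≠ 0`, so that `D` can be solved for.
  (X 0 ^ 2 - C 4) * (X 4 ^ 2 - X 0 * X 1 * X 4 + X 1 ^ 2 + X 0 ^ 2 - C 4) *
    (X 4 ^ 2 - X 0 * X 1 * X 4 + X 1 ^ 2) *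
    (X 0 ^ 2 + X 1 ^ 2 + X 4 ^ 2 - X 0 * X 1 * X 4 - X 2 ^ 2)

theorem eval_genericPoly_ne_zero_iff (t : Fin 6 → ℂ) : eval t genericPoly ≠ 0 ↔
    t 0 ^ 2 - 4 ≠ 0 ∧ t 4 ^ 2 - t 0 * t 1 * t 4 + t 1 ^ 2 + t 0 ^ 2 - 4 ≠ 0 ∧
      t 4 ^ 2 - t 0 * t 1 * t 4 + t 1 ^ 2 ≠ 0 ∧
      t 0 ^ 2 + t 1 ^ 2 + t 4 ^ 2 - t 0 * t 1 * t 4 - t 2 ^ 2 ≠ 0 := by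
  simp only [genericPoly, map_mul, map_sub, map_add, map_pow, eval_X, eval_C, mul_ne_zero_iff,
    and_assoc]

theorem genericPoly_ne_zero : genericPoly ≠ 0 := by
  intro h
  have := (eval_genericPoly_ne_zero_iff ![0, 1, 0, 0, 0, 0]).2 (by simp; norm_num)
  rw [h, map_zero] at this
  exact this rfl

theorem exists_traceVector_eq {t : Fin 6 → ℂ} (ht : eval t genericPoly ≠ 0) :
    ∃ ρ, traceVector ρ = t := by
  obtain ⟨h1, h2, h3, h4⟩ := (eval_genericPoly_ne_zero_iff t).1 ht
  obtain ⟨ρ, e0, e1, e2, e3, e4, e5⟩ :=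
    exists_rep_of_traces (t 0) (t 1) (t 2) (t 3) (t 4) (t 5) h1 h2 h3 h4
  refine ⟨ρ, ?_⟩
  rw [traceVector_eq, e0, e1, e2, e3, e4, e5]
  funext i
  fin_cases i <;> rfl

theorem algebraicIndependent_sixTraces : AlgebraicIndependent ℂ (sixTraces ℂ) := by
  rw [algebraicIndependent_iff]
  intro P hP
  have h : P * genericPoly = 0 := by
    apply MvPolynomial.funext
    intro t
    rw [map_mul, map_zero]
    by_cases ht : eval t genericPoly = 0
    · rw [ht, mul_zero]
    · obtain ⟨ρ, rfl⟩ := exists_traceVector_eq ht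
      rw [← evalAt_aeval, hP, map_zero, zero_mul]
  exact (mul_eq_zero.1 h).resolve_right genericPoly_ne_zero

/-! ### Algebraicity over the six traces -/

/-- The subalgebra generated by the six traces. -/
noncomputable abbrev traceSubalgebra : Subalgebra ℂ (coordinateRing ℂ) :=
  Algebra.adjoin ℂ (Set.range (sixTraces ℂ))

/-- A base without zero divisors makes algebraic elements closed under sums and products, even in
the non-domain `GenericRep → ℂ`. -/
instance : IsDomain traceSubalgebra :=
  algebraicIndependent_sixTraces.aevalEquiv.symm.toMulEquiv.isDomain _

instance : Nontrivial traceSubalgebra := IsDomain.toNontrivial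

/-- The representations satisfying the genericity condition. -/
abbrev GenericRep : Type := {ρ : RepSpace ℂ // eval (traceVector ρ) genericPoly ≠ 0}

/-- Restriction of invariant functions to the generic representations. -/
noncomputable def restrictGeneric : coordinateRing ℂ →ₐ[ℂ] (GenericRep → ℂ) :=
  AlgHom.pi fun ρ : GenericRep => evalAt ρ.1

noncomputable instance : Algebra traceSubalgebra (GenericRep → ℂ) :=
  (restrictGeneric.comp traceSubalgebra.val).toRingHom.toAlgebra

theorem exists_conj_normalForm (ρ : GenericRep) : ∃ P : SpecialLinearGroup (Fin 2) ℂ,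
    ((conj P ρ.1).1 0).1 0 1 = 0 ∧ ((conj P ρ.1).1 0).1 1 0 = 0 ∧
      ((conj P ρ.1).1 1).1 0 1 = 1 := by
  obtain ⟨h1, h2, -, -⟩ := (eval_genericPoly_ne_zero_iff _).1 ρ.2
  rw [traceVector_eq] at h1 h2
  exact exists_conj_normal_form (ρ.1.1 0) (ρ.1.1 1) h1 h2

theorem traceVector_conj (P : SpecialLinearGroup (Fin 2) ℂ) (ρ : RepSpace ℂ) :
    traceVector (conj P ρ) = traceVector ρ :=
  _root_.funext fun i => (sixTraces ℂ i).2.2 P ρ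

/-- The functions on the generic representations which are algebraic over the six traces. -/
noncomputable def algebraicFunctions : Subring (GenericRep → ℂ) where
  carrier := {g | IsAlgebraic traceSubalgebra g}
  mul_mem' := IsAlgebraic.mul
  add_mem' := IsAlgebraic.add
  neg_mem' := IsAlgebraic.neg
  zero_mem' := isAlgebraic_zero
  one_mem' := isAlgebraic_one

theorem mem_algebraicFunctions {g : GenericRep → ℂ} :
    g ∈ algebraicFunctions ↔ IsAlgebraic traceSubalgebra g := Iff.rfl

theorem restrictGeneric_mem {g : coordinateRing ℂ} (hg : g ∈ traceSubalgebra) :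
    restrictGeneric g ∈ algebraicFunctions :=
  mem_algebraicFunctions.2
    (isAlgebraic_algebraMap (A := GenericRep → ℂ) (⟨g, hg⟩ : traceSubalgebra))

theorem sqrt_mem_algebraicFunctions (g : GenericRep → ℂ) (hg : g ^ 2 ∈ algebraicFunctions) :
    g ∈ algebraicFunctions :=
  IsAlgebraic.of_pow (R := traceSubalgebra) two_pos hg

theorem inv_mem_algebraicFunctions (g : GenericRep → ℂ) (hg : g ∈ algebraicFunctions)
    (hg0 : ∀ u, g u ≠ 0) : g⁻¹ ∈ algebraicFunctions := by
  let _ : Invertible g := ⟨g⁻¹, by funext u; simp [hg0 u], by funext u; simp [hg0 u]⟩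
  exact IsAlgebraic.invOf (R := traceSubalgebra) (x := g) hg

theorem aeval_pi_apply {U σ : Type*} (g : σ → U → ℂ) (F : MvPolynomial σ ℂ) (u : U) :
    aeval g F u = aeval (fun v => g v u) F :=
  AlgHom.congr_fun (MvPolynomial.comp_aeval g (Pi.evalAlgHom ℂ (fun _ => ℂ) u)) F

theorem isAlgebraic_restrictGeneric (f : coordinateRing ℂ) :
    IsAlgebraic traceSubalgebra (restrictGeneric f) := by
  -- `P` is chosen pointwise with no regularity; the entries only have to satisfy their equations in
  -- the ring of all functions.
  choose P hA01 hA10 hB01 using exists_conj_normalForm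
  have hT (i : Fin 6) : (fun ρ : GenericRep => traceVector ρ.1 i) ∈ algebraicFunctions :=
    restrictGeneric_mem (Algebra.subset_adjoin ⟨i, rfl⟩)
  have tr (ρ : GenericRep) := (traceVector_eq (conj (P ρ) ρ.1)).symm.trans (traceVector_conj _ _)
  have hgen (ρ : GenericRep) := (eval_genericPoly_ne_zero_iff _).1 ρ.2
  have key := entries_mem sqrt_mem_algebraicFunctions inv_mem_algebraicFunctions
    (fun ρ => (conj (P ρ) ρ.1).1 0) (fun ρ => (conj (P ρ) ρ.1).1 1)
    (fun ρ => (conj (P ρ) ρ.1).1 2) (fun ρ => (conj (P ρ) ρ.1).1 3) hA01 hA10 hB01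
    (fun ρ => (conj (P ρ) ρ.1).2) (hT 0) (hT 1) (hT 2) (hT 3) (hT 4) (hT 5)
    (fun ρ => congrFun (tr ρ) 0) (fun ρ => congrFun (tr ρ) 1) (fun ρ => congrFun (tr ρ) 2)
    (fun ρ => congrFun (tr ρ) 3) (fun ρ => congrFun (tr ρ) 4) (fun ρ => congrFun (tr ρ) 5)
    (fun ρ => (hgen ρ).1) (fun ρ => (hgen ρ).2.1) (fun ρ => (hgen ρ).2.2.1)
    (fun ρ => (hgen ρ).2.2.2)
  obtain ⟨F, hF⟩ : f.1 ∈ regularFunctions ℂ := f.2.1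
  have hf : restrictGeneric f =
      aeval (fun v (ρ : GenericRep) => entry ℂ v (conj (P ρ) ρ.1)) F := by
    funext ρ
    rw [aeval_pi_apply]
    refine (f.2.2 (P ρ) ρ.1).symm.trans ?_
    exact (congrFun hF.symm _).trans (aeval_pi_apply (entry ℂ) F _)
  rw [hf, ← mem_algebraicFunctions]
  clear hf hF
  induction F using MvPolynomial.induction_on with
  | C c =>
    rw [aeval_C]
    exact restrictGeneric_mem (algebraMap_mem traceSubalgebra c)
  | add p q hp hq =>
    rw [map_add]
    exact add_mem hp hq
  | mul_X p v hp =>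
    rw [map_mul, aeval_X]
    refine mul_mem hp ?_
    obtain ⟨i, r, s⟩ := v
    obtain ⟨h0, h1, h2, h3⟩ := key r s
    fin_cases i <;> assumption

/-- An equation valid on generic representations becomes valid everywhere after multiplication by
`genericPoly` in the traces, so neither density of the generic locus nor irreducibility is needed.
-/
theorem isAlgebraic_coordinateRing : Algebra.IsAlgebraic traceSubalgebra (coordinateRing ℂ) := by
  refine ⟨fun f => ?_⟩
  obtain ⟨p, hp0, hp⟩ := isAlgebraic_restrictGeneric f
  let q : traceSubalgebra := algebraicIndependent_sixTraces.aevalEquiv genericPoly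
  have hq : (q : coordinateRing ℂ) = aeval (sixTraces ℂ) genericPoly :=
    algebraicIndependent_sixTraces.algebraMap_aevalEquiv genericPoly
  have hq0 : q ≠ 0 := by
    simpa only [q, ne_eq, EmbeddingLike.map_eq_zero_iff] using genericPoly_ne_zero
  refine ⟨Polynomial.C q * p, mul_ne_zero (Polynomial.C_ne_zero.2 hq0) hp0, ?_⟩
  rw [map_mul, Polynomial.aeval_C]
  have hres : restrictGeneric (Polynomial.aeval f p) = 0 := by
    rw [← hp, Polynomial.aeval_def, Polynomial.aeval_def, ← AlgHom.coe_toRingHom,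
      Polynomial.hom_eval₂]
    rfl
  apply Subtype.ext
  funext ρ
  change evalAt ρ (q * Polynomial.aeval f p) = 0
  rw [map_mul, hq, evalAt_aeval]
  by_cases h : eval (traceVector ρ) genericPoly = 0
  · rw [h, zero_mul]
  · rw [show evalAt ρ (Polynomial.aeval f p) = 0 from congrFun hres ⟨ρ, h⟩, mul_zero]

end GenusTwo

theorem mainTheorem10 :
    IsTranscendenceBasis ℂ (GenusTwo.sixTraces ℂ) ∧
      Algebra.IsAlgebraic (Algebra.adjoin ℂ (Set.range (GenusTwo.sixTraces ℂ)))
        (GenusTwo.coordinateRing ℂ) :=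
  ⟨isTranscendenceBasis_iff_algebraicIndependent_isAlgebraic.2
    ⟨GenusTwo.algebraicIndependent_sixTraces, GenusTwo.isAlgebraic_coordinateRing⟩,
    GenusTwo.isAlgebraic_coordinateRing⟩
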